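/- Let $K_n$ be the complete graph on $n\ge 2$ vertices. $CNF(K_n)$ is the monotone 3-CNF whose variables are the vertex variables $X_u$ ($u\in V(K_n)$) and the edge variables $X_{u,v}$ ($\{u,v\}\in E(K_n)$), with one clause $(X_u\vee X_{u,v}\vee X_v)$ for each edge $\{u,v\}$ of $K_n$. A nondeterministic branching program (NBP) $Z$ is a finite directed acyclic graph (multiple edges allowed) with exactly one root (source) and one leaf (sink), some of whose edges are labelled with literals of the variables; its size is its number of vertices. A root-leaf path is computational if no two opposite literals of a variable label its edges. $Z$ computes a CNF if an assignment to all the variables satisfies the CNF exactly when it makes all the literals on some computational path true. For an NBP computing $CNF(K_n)$ and an integer $k\ge 0$: it is a $k$-VEMBP (vertex edge monotone branching program) if on every root-leaf path each vertex variable occurs at most $k$ times and all occurrences of edge variables are positive; it is a $k$-VOBP (vertex oblivious branching program) if on every computational path each vertex variable occurs at most $k$ times, and there is one sequence in which each vertex variable occurs exactly $k$ times such that the sequence of vertex variables along every computational path is a (not necessarily contiguous) subsequence of it. Theorem. There is an absolute constant $c>0$ such that the following holds for all integers $k\ge 0$ and $n\ge 2$, with $s=8k+10$. (1) Every $k$-VEMBP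 computing $CNF(K_n)$ has size at least $(8/7)^{c\,n/(2^s(s-1))}$. (2) Every $k$-VOBP computing $CNF(K_n)$ has size at least $2^{n/(2^s(s-1))}$. (3) Both bounds stay exponential for $k\le \log n/a$ with $a$ a sufficiently large constant: for every $\varepsilon>0$ there is $a_0>0$ such that for every $a\ge a_0$, all sufficiently large $n$ and all $k\le (\log_2 n)/a$, both $(8/7)^{c\,n/(2^s(s-1))}$ and $2^{n/(2^s(s-1))}$ are at least $2^{n^{1-\varepsilon}}$. -/

import Mathlib

open Filter

namespace BranchingPrograms

/-- A literal: a variable together with its sign (`true` for the positive literal). -/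
abbrev Literal (X : Type*) := X × Bool

/-- A CNF, as a set of clauses, each clause being a set of literals. -/
abbrev CNF (X : Type*) := Set (Set (Literal X))

/-- The set of literals representing a truth assignment to all the variables. -/
def assignmentLits {X : Type*} (τ : X → Bool) : Set (Literal X) :=
  {l | τ l.1 = l.2}

/-- A set of literals satisfies a CNF if it contains a literal of every clause. -/
def Satisfies {X : Type*} (S : Set (Literal X)) (φ : CNF X) : Prop :=
  ∀ C ∈ φ, ∃ l ∈ C, l ∈ S

/-- The edge sequence `p` is a directed path from the first vertex to the second one
in the directed multigraph given by `src` and `tgt`. -/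
inductive IsPath {V E : Type} (src tgt : E → V) : V → V → List E → Prop
  | nil (v : V) : IsPath src tgt v v []
  | cons (e : E) {w : V} {p : List E} (h : IsPath src tgt (tgt e) w p) :
      IsPath src tgt (src e) w (e :: p)

/-- A nondeterministic branching program over the variables `X`: a finite directed acyclic
multigraph with exactly one root (vertex without incoming edges) and exactly one leaf (vertex
without outgoing edges), some of whose edges are labelled with literals. -/
structure NBP (X : Type*) where
  /-- vertices -/
  V : Type
  /-- edges; multiple edges are allowed -/
  E : Type
  finV : Fintype V
  finE : Fintype E
  src : E → V
  tgt : E → V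
  /-- `none` for the unlabelled edges -/
  label : E → Option (Literal X)
  root : V
  leaf : V
  acyclic : ∀ (v : V) (p : List E), IsPath src tgt v v p → p = []
  root_iff : ∀ v : V, (∀ e : E, tgt e ≠ v) ↔ v = root
  leaf_iff : ∀ v : V, (∀ e : E, src e ≠ v) ↔ v = leaf

namespace NBP

variable {X : Type*} (Z : NBP X)

/-- The size is the number of vertices. -/
def size : ℕ := @Fintype.card Z.V Z.finV

/-- `p` is a root-leaf path. -/
def IsRootLeafPath (p : List Z.E) : Prop := IsPath Z.src Z.tgt Z.root Z.leaf p

/-- The sequence of literals labelling the edges of `p`, in the order of the path. -/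
def lits (p : List Z.E) : List (Literal X) := p.filterMap Z.label

/-- No two opposite literals occur on `p`. -/
def Consistent (p : List Z.E) : Prop :=
  ∀ x : X, ¬ ((x, true) ∈ Z.lits p ∧ (x, false) ∈ Z.lits p)

/-- A computational path is a consistent root-leaf path. -/
def IsComputational (p : List Z.E) : Prop := Z.IsRootLeafPath p ∧ Z.Consistent p

/-- `Z` computes `φ`: an assignment to all the variables satisfies `φ` if and only if it contains
the set of literals of some computational path. -/
def Computes (φ : CNF X) : Prop :=
  ∀ τ : X → Bool, Satisfies (assignmentLits τ) φ ↔
    ∃ p : List Z.E, Z.IsComputational p ∧ ∀ l ∈ Z.lits p, l ∈ assignmentLits τ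

end NBP

/-- The variables of the CNF of a graph `G`: vertex variables and edge variables. -/
inductive GVar {V : Type*} (G : SimpleGraph V) where
  | vertex (u : V) : GVar G
  | edge (e : G.edgeSet) : GVar G

/-- `CNF(G)`, with the clauses `(X_u ∨ X_{u,v} ∨ X_v)` for the edges `{u,v}` of `G`. -/
def graphCNF {V : Type*} (G : SimpleGraph V) : CNF (GVar G) :=
  {C | ∃ (u v : V) (h : G.Adj u v),
    C = {(GVar.vertex u, true), (GVar.edge ⟨s(u, v), G.mem_edgeSet.2 h⟩, true),
      (GVar.vertex v, true)}}

/-- The vertex tested by a literal, if it is a literal of a vertex variable. -/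
def litVertex? {V : Type*} {G : SimpleGraph V} : Literal (GVar G) → Option V
  | (GVar.vertex u, _) => some u
  | (GVar.edge _, _) => none

namespace NBP

variable {V : Type*} {G : SimpleGraph V} (Z : NBP (GVar G))

/-- The sequence of the vertices whose variables are tested along `p`, with repetitions. -/
def vertexSeq (p : List Z.E) : List V := (Z.lits p).filterMap litVertex?

/-- `k`-Vertex Edge Monotone Branching Program: on each root-leaf path each vertex variable occurs
at most `k` times and the edge variables occur only positively. -/
def IsVEMBP [DecidableEq V] (k : ℕ) : Prop :=
  ∀ p : List Z.E, Z.IsRootLeafPath p →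
    (∀ u : V, (Z.vertexSeq p).count u ≤ k) ∧
    (∀ e : G.edgeSet, (GVar.edge e, false) ∉ Z.lits p)

/-- `k`-Vertex Oblivious Branching Program: on each computational path each vertex variable occurs
at most `k` times, and there is one sequence in which each vertex occurs exactly `k` times such
that the vertex sequence of each computational path is a (not necessarily contiguous)
subsequence of it. -/
def IsVOBP [DecidableEq V] (k : ℕ) : Prop :=
  (∀ p : List Z.E, Z.IsComputational p → ∀ u : V, (Z.vertexSeq p).count u ≤ k) ∧
  ∃ L : List V, (∀ u : V, L.count u = k) ∧
    ∀ p : List Z.E, Z.IsComputational p → (Z.vertexSeq p).Sublist L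

end NBP

end BranchingPrograms

/-! ### Paths in multigraphs, pigeonhole, and mixtures of two paths -/

namespace BranchingPrograms

/-! Both lower bounds are cut-and-paste arguments. Take a large family of satisfying assignments and
an accepting path for each. Extract a subfamily, not much smaller, any two of whose paths can be
spliced: some root-leaf path uses only literals of the two, reading the vertex variables in `U` as
the first path does and those in `W` as the second does. Here `U` and `W` are disjoint, of common
size `m` of order at least `n / 4 ^ k`, up to additive constants. If a splice is true under an
assignment falsifying a clause, the program is wrong. Hence the subfamily has no bad pair and must
be small, which forces the program to be large.

For VEMBPs the family is indexed by all vertex sets `C`: the vertices of `C` and the edges missing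
`C` are true. Suppose `C` and `D` agree outside `U ∪ W`, with `u ∈ U` in `D` only and `w ∈ W` in `C`
only. The splice is then compatible with `u` and `w` false, and neither path asserts the edge `uw`,
so its clause can fail. By `card_mul_two_pow_le`, a family without such pairs has at most `2 ^ n *
(m + 2) / 2 ^ m` members. Splices come from `mixesFamilies`, an induction on the number of tests
still allowed.

For VOBPs negative edge literals may occur, so all assignments of the family share their edge
values: only the edges of a perfect matching of `U` with `W` are false. For `S ⊆ U`, a vertex of `U`
is true iff it lies in `S`, and its partner iff it does not. A vertex of `T \ S` yields a falsified
matching clause, so a spliceable subfamily has at most one member. Splices come from cutting the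
oblivious sequence into segments avoiding `U` or `W` (`exists_segments`) and pigeonholing on the
program vertices at the cuts (`exists_mixing_of_segments`). -/

theorem IsPath.append {V E : Type} {src tgt : E → V} {x y z : V} {p q : List E}
    (hp : IsPath src tgt x y p) (hq : IsPath src tgt y z q) : IsPath src tgt x z (p ++ q) := by
  induction hp with
  | nil v => simpa using hq
  | cons e h ih => exact IsPath.cons e (ih hq)

theorem IsPath.exists_of_append {V E : Type} {src tgt : E → V} {q : List E} :
    ∀ {x z : V} {p : List E}, IsPath src tgt x z (p ++ q) →
      ∃ y, IsPath src tgt x y p ∧ IsPath src tgt y z q := by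
  intro x z p
  induction p generalizing x with
  | nil => intro h; exact ⟨x, .nil x, h⟩
  | cons e p ih =>
    intro h
    cases h with
    | cons _ h =>
      obtain ⟨y, h1, h2⟩ := ih h
      exact ⟨y, .cons e h1, h2⟩

/-- A path from a vertex satisfying `Φ` to a vertex violating `Φ` leaves `Φ` along some edge. -/
theorem IsPath.exists_crossing {V E : Type} {src tgt : E → V} {Φ : V → Prop} {x z : V}
    {p : List E} (h : IsPath src tgt x z p) (hx : Φ x) (hz : ¬ Φ z) :
    ∃ p₁ e p₂, p = p₁ ++ e :: p₂ ∧ IsPath src tgt x (src e) p₁ ∧ IsPath src tgt (tgt e) z p₂ ∧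
      Φ (src e) ∧ ¬ Φ (tgt e) := by
  induction h with
  | nil v => exact absurd hx hz
  | cons e h ih =>
    by_cases hy : Φ (tgt e)
    · obtain ⟨p₁, e', p₂, rfl, h1, h2, h3, h4⟩ := ih hy hz
      exact ⟨e :: p₁, e', p₂, rfl, .cons e h1, h2, h3, h4⟩
    · exact ⟨[], e, _, rfl, .nil _, h, hx, hy⟩

/-- The pigeonhole principle: some fibre has at least the average size. -/
theorem exists_card_le_card_fiber_mul {ι K : Type*} [Fintype K] [DecidableEq K] [Nonempty K]
    (I : Finset ι) (g : ι → K) :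
    ∃ y, I.card ≤ (I.filter fun i => g i = y).card * Fintype.card K := by
  by_contra! h
  obtain ⟨y, -, hy⟩ := Finset.exists_max_image (Finset.univ : Finset K)
    (fun y => (I.filter fun i => g i = y).card) Finset.univ_nonempty
  have h1 : I.card = ∑ y : K, (I.filter fun i => g i = y).card :=
    Finset.card_eq_sum_card_fiberwise (fun _ _ => Finset.mem_coe.2 (Finset.mem_univ _))
  have h2 : ∑ z : K, (I.filter fun i => g i = z).card ≤
      Fintype.card K • (I.filter fun i => g i = y).card :=
    Finset.sum_le_card_nsmul _ _ _ (fun z hz => hy z hz)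
  have h3 := h y
  rw [smul_eq_mul, mul_comm] at h2
  omega

namespace NBP

variable {X : Type*} (Z : NBP X)

@[simp] theorem lits_append (p q : List Z.E) : Z.lits (p ++ q) = Z.lits p ++ Z.lits q := by
  simp [lits]

theorem size_pos : 0 < Z.size := by
  let _ := Z.finV
  exact Fintype.card_pos_iff.2 ⟨Z.root⟩

/-- A root-leaf path all of whose literals hold under `τ` witnesses that `τ` satisfies the
computed CNF. -/
theorem Computes.satisfies {Z : NBP X} {φ : CNF X} (h : Z.Computes φ) {τ : X → Bool}
    {p : List Z.E} (hp : Z.IsRootLeafPath p) (hl : ∀ l ∈ Z.lits p, l ∈ assignmentLits τ) :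
    Satisfies (assignmentLits τ) φ := by
  refine (h τ).2 ⟨p, ⟨hp, fun x hx => ?_⟩, hl⟩
  have h1 := hl _ hx.1
  have h2 := hl _ hx.2
  simp only [assignmentLits, Set.mem_ofPred_eq] at h1 h2
  simp [h1] at h2

variable {V : Type*} {G : SimpleGraph V} (Z : NBP (GVar G))

@[simp] theorem vertexSeq_append (p q : List Z.E) :
    Z.vertexSeq (p ++ q) = Z.vertexSeq p ++ Z.vertexSeq q := by
  simp [vertexSeq]

theorem mem_vertexSeq {p : List Z.E} {u : V} {b : Bool} (h : (GVar.vertex u, b) ∈ Z.lits p) :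
    u ∈ Z.vertexSeq p :=
  List.mem_filterMap.2 ⟨_, h, rfl⟩

/-- `r` is composed of literals of `p` and `q`, the literals of the vertex variables in `U` being
taken from `p` and those of the vertex variables in `W` from `q`. -/
structure Mixes (U W : Finset V) (p q r : List Z.E) : Prop where
  sub : ∀ l ∈ Z.lits r, l ∈ Z.lits p ∨ l ∈ Z.lits q
  left : ∀ u ∈ U, ∀ b, (GVar.vertex u, b) ∈ Z.lits r → (GVar.vertex u, b) ∈ Z.lits p
  right : ∀ w ∈ W, ∀ b, (GVar.vertex w, b) ∈ Z.lits r → (GVar.vertex w, b) ∈ Z.lits q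

variable {Z}

theorem Mixes.mono {U U' W W' : Finset V} {p q r : List Z.E} (h : Z.Mixes U W p q r)
    (hU : U' ⊆ U) (hW : W' ⊆ W) : Z.Mixes U' W' p q r :=
  ⟨h.sub, fun u hu => h.left u (hU hu), fun w hw => h.right w (hW hw)⟩

theorem Mixes.symm {U W : Finset V} {p q r : List Z.E} (h : Z.Mixes U W p q r) :
    Z.Mixes W U q p r :=
  ⟨fun l hl => (h.sub l hl).symm, h.right, h.left⟩

/-- The source of all splices: a path that never tests `W` is itself a splice with any other path.
-/
theorem Mixes.of_notMem_right {U W : Finset V} {p : List Z.E} (q : List Z.E)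
    (h : ∀ w ∈ W, w ∉ Z.vertexSeq p) : Z.Mixes U W p q p :=
  ⟨fun _ => .inl, fun _ _ _ => id, fun w hw _ hl => absurd (Z.mem_vertexSeq hl) (h w hw)⟩

theorem Mixes.append {U W : Finset V} {p p' q q' r r' : List Z.E} (h : Z.Mixes U W p q r)
    (h' : Z.Mixes U W p' q' r') : Z.Mixes U W (p ++ p') (q ++ q') (r ++ r') := by
  refine ⟨fun l hl => ?_, fun u hu b hl => ?_, fun u hu b hl => ?_⟩
  · simp only [lits_append, List.mem_append] at hl ⊢
    rcases hl with hl | hl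
    · have := h.sub l hl; tauto
    · have := h'.sub l hl; tauto
  · simp only [lits_append, List.mem_append] at hl ⊢
    exact hl.imp (h.left u hu b) (h'.left u hu b)
  · simp only [lits_append, List.mem_append] at hl ⊢
    exact hl.imp (h.right u hu b) (h'.right u hu b)

end NBP
end BranchingPrograms

/-! ### Splicing paths under a bound on the tests along every path -/

namespace BranchingPrograms
namespace NBP

variable {V : Type*} {G : SimpleGraph V} (Z : NBP (GVar G))

/-- The vertex tested by an edge of the program, if any. -/
def edgeVertex? (e : Z.E) : Option V := (Z.label e).bind litVertex?

theorem mem_vertexSeq_cons {e : Z.E} {p : List Z.E} {u : V} :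
    u ∈ Z.vertexSeq (e :: p) ↔ Z.edgeVertex? e = some u ∨ u ∈ Z.vertexSeq p := by
  unfold vertexSeq lits edgeVertex?
  cases h : Z.label e with
  | none => simp [h]
  | some l =>
    cases h' : litVertex? l with
    | none => simp [h, h']
    | some w => simp [h, h', eq_comm]

section
variable [Fintype V]

open Classical in
/-- The vertices tested on the paths from `x` to `y`. -/
noncomputable def testedBetween (x y : Z.V) : Finset V :=
  Finset.univ.filter fun u => ∃ p, IsPath Z.src Z.tgt x y p ∧ u ∈ Z.vertexSeq p

theorem mem_testedBetween {x y : Z.V} {u : V} :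
    u ∈ Z.testedBetween x y ↔ ∃ p, IsPath Z.src Z.tgt x y p ∧ u ∈ Z.vertexSeq p := by
  simp [testedBetween]

theorem testedBetween_self (v : Z.V) : Z.testedBetween v v = ∅ := by
  ext u
  simp only [mem_testedBetween, Finset.notMem_empty, iff_false, not_exists, not_and]
  intro p hp
  rw [Z.acyclic v p hp]
  simp [vertexSeq, lits]

end

/-- Up to a factor `c`, the family `f` of paths from the root to `v` contains a subfamily that can
be mixed along large sets of vertices. -/
def HasMixing {ι : Type*} (v : Z.V) (A B : Finset V) (I : Finset ι) (f : ι → List Z.E)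
    (M t c : ℕ) : Prop :=
  ∃ I' ⊆ I, ∃ A' ⊆ A, ∃ B' ⊆ B, M + 2 ≤ 2 ^ t * (A'.card + 2) ∧ M + 2 ≤ 2 ^ t * (B'.card + 2) ∧
    I.card ≤ I'.card * c ∧ ∀ i ∈ I', ∀ j ∈ I', ∃ r, IsPath Z.src Z.tgt Z.root v r ∧
      Z.Mixes A' B' (f i) (f j) r

variable {Z}

theorem HasMixing.symm {ι : Type*} {v : Z.V} {A B : Finset V} {I : Finset ι} {f : ι → List Z.E}
    {M t c : ℕ} (h : Z.HasMixing v A B I f M t c) : Z.HasMixing v B A I f M t c := by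
  obtain ⟨I', hI', A', hA', B', hB', h1, h2, h3, h4⟩ := h
  refine ⟨I', hI', B', hB', A', hA', h2, h1, h3, fun i hi j hj => ?_⟩
  obtain ⟨r, hr, hm⟩ := h4 j hj i hi
  exact ⟨r, hr, hm.symm⟩

variable [DecidableEq V]

variable (Z) in
/-- On the paths from the root to `v`, the vertices of `A` are tested at most `a` times. -/
def TestsAtMost (v : Z.V) (A : Finset V) (a : ℕ) : Prop :=
  ∀ p, IsPath Z.src Z.tgt Z.root v p → ∀ u ∈ A, (Z.vertexSeq p).count u ≤ a

variable (Z) in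
/-- All families of paths to `v` can be mixed along large subsets of vertex sets tested at most
`a` and `b` times. -/
def MixesFamilies (ι : Type*) (v : Z.V) (a b t c : ℕ) : Prop :=
  ∀ (A B : Finset V) (M : ℕ) (I : Finset ι) (f : ι → List Z.E), M ≤ A.card → M ≤ B.card →
    Z.TestsAtMost v A a → Z.TestsAtMost v B b →
    (∀ i ∈ I, IsPath Z.src Z.tgt Z.root v (f i)) → Z.HasMixing v A B I f M t c

theorem MixesFamilies.symm {ι : Type*} {v : Z.V} {a b t c : ℕ}
    (h : Z.MixesFamilies ι v a b t c) : Z.MixesFamilies ι v b a t c :=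
  fun A B M I f hA hB ha hb hf => (h B A M I f hB hA hb ha hf).symm

variable [Fintype V]

variable (Z) in
/-- The path `p` to `v` passes through an edge from `x` to `y` testing `o`. -/
def Crosses (v x y : Z.V) (o : Option V) (p : List Z.E) : Prop :=
  ∃ p₁ e p₂, p = p₁ ++ e :: p₂ ∧ IsPath Z.src Z.tgt Z.root x p₁ ∧ Z.src e = x ∧ Z.tgt e = y ∧
    Z.edgeVertex? e = o ∧ IsPath Z.src Z.tgt y v p₂

/-- A vertex of `A` tested on some path from `x` to `v` loses one test on the paths from the root to
`x`, consistent or not. Vertices of `B` neither tested after `y` nor equal to `o` are absent from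
the tail of each given path after `x`. So prefixes are spliced at `x` by induction, and the tail of
the first path is appended. -/
theorem hasMixing_of_crosses {ι : Type*} {v x y : Z.V} {o : Option V} {a b t c M : ℕ}
    (ih : Z.MixesFamilies ι x a b t c) {A B : Finset V} {I : Finset ι} {f : ι → List Z.E}
    (hB : M ≤ B.card) (ha : Z.TestsAtMost v A (a + 1)) (hb : Z.TestsAtMost v B b)
    (hf : ∀ i ∈ I, Z.Crosses v x y o (f i)) (hx : M < 2 * (A ∩ Z.testedBetween x v).card)
    (hy : 2 * (B ∩ Z.testedBetween y v).card ≤ M) : Z.HasMixing v A B I f M (t + 1) c := by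
  rcases I.eq_empty_or_nonempty with rfl | ⟨i₀, hi₀⟩
  · refine ⟨∅, subset_rfl, A, subset_rfl, B, subset_rfl, ?_, ?_, by simp, by simp⟩
    · have : (A ∩ Z.testedBetween x v).card ≤ A.card := Finset.card_le_card Finset.inter_subset_left
      calc M + 2 ≤ 2 * (A.card + 2) := by omega
        _ ≤ 2 ^ (t + 1) * (A.card + 2) := by
          gcongr; rw [pow_succ]; have := Nat.one_le_two_pow (n := t); omega
    · calc M + 2 ≤ 1 * (B.card + 2) := by omega
        _ ≤ 2 ^ (t + 1) * (B.card + 2) := by gcongr; exact Nat.one_le_two_pow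
  set A₁ := A ∩ Z.testedBetween x v with hA₁
  set B₁ := (B \ Z.testedBetween y v) \ o.toFinset with hB₁
  have key : ∀ i ∈ I, ∃ p q, f i = p ++ q ∧ IsPath Z.src Z.tgt Z.root x p ∧
      IsPath Z.src Z.tgt x v q ∧ ∀ u ∈ B₁, u ∉ Z.vertexSeq q := by
    intro i hi
    obtain ⟨p, e, q, hpq, hp, rfl, rfl, ho, hq⟩ := hf i hi
    refine ⟨p, e :: q, hpq, hp, .cons e hq, fun u hu hu' => ?_⟩
    rw [mem_vertexSeq_cons, ho] at hu'
    simp only [hB₁, Finset.mem_sdiff, mem_testedBetween, Option.mem_toFinset, Option.mem_def,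
      not_exists, not_and] at hu
    rcases hu' with h | h
    · exact hu.2 h
    · exact hu.1.2 _ hq h
  choose! p q hpq hp hq hBq using key
  have hcB : B.card ≤ B₁.card + (B ∩ Z.testedBetween y v).card + 1 := by
    have h1 := Finset.card_sdiff_add_card_inter B (Z.testedBetween y v)
    have h2 := Finset.le_card_sdiff o.toFinset (B \ Z.testedBetween y v)
    have h3 : o.toFinset.card ≤ 1 := by cases o <;> simp
    rw [← hB₁] at h2
    omega
  -- The `- 1` pays for removing `o` from `B`. In terms of `M + 2` the loss is then at most a factor
  -- of two.
  obtain ⟨I', hI', A', hA', B', hB', h1, h2, h3, h4⟩ :=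
    ih A₁ B₁ ((M + 1) / 2 - 1) I p (by omega) (by omega) (by
      intro p hp u hu
      simp only [hA₁, Finset.mem_inter, mem_testedBetween] at hu
      obtain ⟨hu, p', hp', hup'⟩ := hu
      have h1 := ha _ (hp.append hp') u hu
      have h2 := List.count_pos_iff.2 hup'
      rw [vertexSeq_append, List.count_append] at h1
      omega) (by
      intro p' hp' u hu
      simp only [hB₁, Finset.mem_sdiff] at hu
      have h1 := hb _ (hp'.append (hq i₀ hi₀)) u hu.1.1
      rw [vertexSeq_append, List.count_append] at h1
      omega) hp
  refine ⟨I', hI', A', hA'.trans Finset.inter_subset_left, B',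
    hB'.trans (Finset.sdiff_subset.trans Finset.sdiff_subset), ?_, ?_, h3, fun i hi j hj => ?_⟩
  · rw [pow_succ, mul_right_comm]; omega
  · rw [pow_succ, mul_right_comm]; omega
  · obtain ⟨r, hr, hm⟩ := h4 i hi j hj
    refine ⟨r ++ q i, hr.append (hq i (hI' hi)), ?_⟩
    rw [hpq i (hI' hi), hpq j (hI' hj)]
    exact hm.append (Mixes.of_notMem_right _ fun w hw => hBq i (hI' hi) w (hB' hw))

theorem testsAtMost_pos {v x : Z.V} {A : Finset V} {a : ℕ} {p : List Z.E}
    (ha : Z.TestsAtMost v A a) (hp : IsPath Z.src Z.tgt Z.root x p)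
    (hA : 0 < (A ∩ Z.testedBetween x v).card) : 0 < a := by
  obtain ⟨u, hu⟩ := Finset.card_pos.1 hA
  simp only [Finset.mem_inter, mem_testedBetween] at hu
  obtain ⟨hu, q, hq, huq⟩ := hu
  have h1 := ha _ (hp.append hq) u hu
  have h2 := List.count_pos_iff.2 huq
  rw [vertexSeq_append, List.count_append] at h1
  omega

/-- Call a program vertex heavy if the paths from it to `v` test more than `M / 2` vertices of `A`
or of `B`. If the root is light, dropping the tested vertices makes every path its own splice.
Otherwise each path leaves the heavy region along an edge, and the paths sharing the data of that
edge are treated by `hasMixing_of_crosses`, with one test fewer. -/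
theorem mixesFamilies (ι : Type*) (t a b : ℕ) (hab : a + b = t) (v : Z.V) :
    Z.MixesFamilies ι v a b t ((2 * (Fintype.card V + 1) * Z.size ^ 2) ^ t) := by
  induction t generalizing a b v with
  | zero =>
    obtain ⟨rfl, rfl⟩ : a = 0 ∧ b = 0 := by omega
    intro A B M I f hA hB ha hb hf
    refine ⟨I, subset_rfl, A, subset_rfl, B, subset_rfl, by omega, by omega, by simp,
      fun i hi j hj => ⟨f i, hf i hi, Mixes.of_notMem_right _ fun w hw h => ?_⟩⟩
    have := hb _ (hf i hi) w hw
    have := List.count_pos_iff.2 h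
    omega
  | succ t ih =>
    intro A B M I f hA hB ha hb hf
    set N := 2 * (Fintype.card V + 1) * Z.size ^ 2 with hN
    have hNpos : 0 < N := by
      have := Z.size_pos
      positivity
    let Φ : Z.V → Prop := fun x => M < 2 * (A ∩ Z.testedBetween x v).card ∨
      M < 2 * (B ∩ Z.testedBetween x v).card
    by_cases hroot : Φ Z.root
    · have hv : ¬ Φ v := by simp [Φ, testedBetween_self]
      let _ := Z.finV
      -- The code records which side is heavy, the vertex tested by the crossing edge and its
      -- endpoints. The edge itself is not recorded, because parallel edges are not bounded by the
      -- size.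
      have hcode : ∀ i, ∃ κ : Bool × Option V × Z.V × Z.V, i ∈ I →
          Z.Crosses v κ.2.2.1 κ.2.2.2 κ.2.1 (f i) ∧ ¬ Φ κ.2.2.2 ∧
          (if κ.1 then M < 2 * (A ∩ Z.testedBetween κ.2.2.1 v).card
            else M < 2 * (B ∩ Z.testedBetween κ.2.2.1 v).card) := by
        intro i
        by_cases hi : i ∈ I
        · obtain ⟨p₁, e, p₂, h1, h2, h3, h4, h5⟩ := (hf i hi).exists_crossing hroot hv
          have hc : Z.Crosses v (Z.src e) (Z.tgt e) (Z.edgeVertex? e) (f i) :=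
            ⟨p₁, e, p₂, h1, h2, rfl, rfl, rfl, h3⟩
          rcases h4 with h4 | h4
          · exact ⟨(true, Z.edgeVertex? e, Z.src e, Z.tgt e), fun _ => ⟨hc, h5, by simpa using h4⟩⟩
          · exact ⟨(false, Z.edgeVertex? e, Z.src e, Z.tgt e), fun _ => ⟨hc, h5, by simpa using h4⟩⟩
        · exact ⟨(true, none, Z.root, Z.root), fun h => absurd h hi⟩
      choose g hg using hcode
      classical
      have : Nonempty Z.V := ⟨Z.root⟩
      obtain ⟨⟨s, o, x, y⟩, hκ⟩ := exists_card_le_card_fiber_mul I g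
      set I₁ := I.filter fun i => g i = (s, o, x, y) with hI₁
      have hcard : Fintype.card (Bool × Option V × Z.V × Z.V) = N := by
        simp only [Fintype.card_prod, Fintype.card_bool, Fintype.card_option, hN, size]
        ring
      rw [hcard] at hκ
      have hmain : Z.HasMixing v A B I₁ f M (t + 1) (N ^ t) := by
        rcases I₁.eq_empty_or_nonempty with h0 | ⟨i₀, hi₀⟩
        · rw [h0]
          refine ⟨∅, subset_rfl, A, subset_rfl, B, subset_rfl, ?_, ?_, by simp, by simp⟩
          · calc M + 2 ≤ 1 * (A.card + 2) := by omega
              _ ≤ 2 ^ (t + 1) * (A.card + 2) := by gcongr; exact Nat.one_le_two_pow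
          · calc M + 2 ≤ 1 * (B.card + 2) := by omega
              _ ≤ 2 ^ (t + 1) * (B.card + 2) := by gcongr; exact Nat.one_le_two_pow
        have hI : ∀ i ∈ I₁, Z.Crosses v x y o (f i) ∧ ¬ Φ y ∧
            (if s then M < 2 * (A ∩ Z.testedBetween x v).card
              else M < 2 * (B ∩ Z.testedBetween x v).card) := by
          intro i hi
          rw [hI₁, Finset.mem_filter] at hi
          have := hg i hi.1
          rwa [hi.2] at this
        obtain ⟨⟨p, -, -, -, hp, -⟩, hy, hx⟩ := hI i₀ hi₀
        simp only [Φ, not_or, not_lt] at hy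
        cases s with
        | true =>
          simp only [if_true] at hx
          obtain ⟨a, rfl⟩ := Nat.exists_eq_succ_of_ne_zero
            (testsAtMost_pos ha hp (by omega)).ne'
          exact hasMixing_of_crosses (ih a b (by omega) x) hB ha hb (fun i hi => (hI i hi).1)
            hx hy.2
        | false =>
          simp only [Bool.false_eq_true, if_false] at hx
          obtain ⟨b, rfl⟩ := Nat.exists_eq_succ_of_ne_zero
            (testsAtMost_pos hb hp (by omega)).ne'
          exact (hasMixing_of_crosses (ih a b (by omega) x).symm hA hb ha
            (fun i hi => (hI i hi).1) hx hy.1).symm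
      obtain ⟨I', hI', A', hA', B', hB', h1, h2, h3, h4⟩ := hmain
      refine ⟨I', hI'.trans (Finset.filter_subset _ _), A', hA', B', hB', h1, h2, ?_, h4⟩
      calc I.card ≤ I₁.card * N := hκ
        _ ≤ I'.card * N ^ t * N := by gcongr
        _ = I'.card * N ^ (t + 1) := by ring
    · simp only [Φ, not_or, not_lt] at hroot
      have hle : ∀ C : Finset V, M ≤ C.card → 2 * (C ∩ Z.testedBetween Z.root v).card ≤ M →
          M + 2 ≤ 2 ^ (t + 1) * ((C \ Z.testedBetween Z.root v).card + 2) := by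
        intro C hC h
        have h1 := Finset.card_sdiff_add_card_inter C (Z.testedBetween Z.root v)
        calc M + 2 ≤ 2 * ((C \ Z.testedBetween Z.root v).card + 2) := by omega
          _ ≤ 2 ^ (t + 1) * ((C \ Z.testedBetween Z.root v).card + 2) := by
            gcongr; rw [pow_succ]; have := Nat.one_le_two_pow (n := t); omega
      refine ⟨I, subset_rfl, A \ Z.testedBetween Z.root v, Finset.sdiff_subset,
        B \ Z.testedBetween Z.root v, Finset.sdiff_subset, hle A hA hroot.1, hle B hB hroot.2,
        Nat.le_mul_of_pos_right _ (pow_pos hNpos _), fun i hi j hj =>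
        ⟨f i, hf i hi, Mixes.of_notMem_right _ fun w hw h => ?_⟩⟩
      rw [Finset.mem_sdiff, mem_testedBetween] at hw
      exact hw.2 ⟨f i, hf i hi, h⟩

end NBP
end BranchingPrograms

/-! ### Splicing paths that follow an oblivious sequence -/

namespace BranchingPrograms

/-- Two sets of letters have large subsets such that the list `L` splits into few segments, each
of which avoids one of the subsets. -/
theorem exists_segments {V : Type*} [DecidableEq V] (t : ℕ) :
    ∀ (a b : ℕ), a + b = t → ∀ (L : List V) (A B : Finset V) (M : ℕ), Disjoint A B →
      M ≤ A.card → M ≤ B.card → (∀ u ∈ A, L.count u ≤ a) → (∀ u ∈ B, L.count u ≤ b) →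
      ∃ A' ⊆ A, ∃ B' ⊆ B, M ≤ 2 ^ t * A'.card ∧ M ≤ 2 ^ t * B'.card ∧
        ∃ Ls : List (List V), Ls.flatten = L ∧ Ls.length ≤ t + 1 ∧
          ∀ S ∈ Ls, (∀ u ∈ A', u ∉ S) ∨ (∀ u ∈ B', u ∉ S) := by
  induction t with
  | zero =>
    intro a b hab L A B M _ hA hB ha hb
    refine ⟨A, subset_rfl, B, subset_rfl, by omega, by omega, [L], by simp, by simp, ?_⟩
    simp only [List.mem_singleton, forall_eq]
    left
    intro u hu h
    have := List.count_pos_iff.2 h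
    have := ha u hu
    omega
  | succ t ih =>
    have step : ∀ (a b : ℕ), a + 1 + b = t + 1 → ∀ (L₁ L₂ : List V) (x : V) (A B : Finset V)
        (M : ℕ), Disjoint A B → x ∈ A → M ≤ B.card → (∀ u ∈ A, (L₁ ++ x :: L₂).count u ≤ a + 1) →
        (∀ u ∈ B, (L₁ ++ x :: L₂).count u ≤ b) → M < 2 * (A ∩ (x :: L₂).toFinset).card →
        2 * (B ∩ L₂.toFinset).card ≤ M →
        ∃ A' ⊆ A, ∃ B' ⊆ B, M ≤ 2 ^ (t + 1) * A'.card ∧ M ≤ 2 ^ (t + 1) * B'.card ∧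
          ∃ Ls : List (List V), Ls.flatten = L₁ ++ x :: L₂ ∧ Ls.length ≤ t + 1 + 1 ∧
            ∀ S ∈ Ls, (∀ u ∈ A', u ∉ S) ∨ (∀ u ∈ B', u ∉ S) := by
      -- The suffix `x :: L₂` becomes a segment avoiding `B \ L₂`: since `x ∈ A` and `A`, `B` are
      -- disjoint, `x` costs `B` nothing, and no additive loss occurs.
      intro a b hab L₁ L₂ x A B M hd hxA hB ha hb h1 h2
      have h3 := Finset.card_sdiff_add_card_inter B L₂.toFinset
      obtain ⟨A', hA', B', hB', hcA, hcB, Ls, hL, hlen, hS⟩ :=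
        ih a b (by omega) L₁ (A ∩ (x :: L₂).toFinset) (B \ L₂.toFinset) ((M + 1) / 2)
          (hd.mono Finset.inter_subset_left Finset.sdiff_subset) (by omega) (by omega) (by
            intro u hu
            rw [Finset.mem_inter, List.mem_toFinset] at hu
            have h4 := ha u hu.1
            have h5 := List.count_pos_iff.2 hu.2
            rw [List.count_append] at h4
            omega) (by
            intro u hu
            rw [Finset.mem_sdiff] at hu
            have h4 := hb u hu.1
            rw [List.count_append] at h4
            omega)
      refine ⟨A', hA'.trans Finset.inter_subset_left, B', hB'.trans Finset.sdiff_subset, ?_, ?_,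
        Ls ++ [x :: L₂], by simp [hL], by simpa using hlen, ?_⟩
      · rw [pow_succ, mul_right_comm]; omega
      · rw [pow_succ, mul_right_comm]; omega
      · intro S hS'
        rw [List.mem_append, List.mem_singleton] at hS'
        rcases hS' with h | rfl
        · exact hS S h
        · right
          intro u hu hux
          have hu := Finset.mem_sdiff.1 (hB' hu)
          rcases List.mem_cons.1 hux with rfl | h
          · exact Finset.disjoint_left.1 hd hxA hu.1
          · exact hu.2 (List.mem_toFinset.2 h)
    intro a b hab L A B M hd hA hB ha hb
    -- Scanning from the right end, `x` is the first letter that makes the suffix test more than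
    -- half of `M` in `A` or `B`.
    have hcross : ∀ L : List V,
        (2 * (A ∩ L.toFinset).card ≤ M ∧ 2 * (B ∩ L.toFinset).card ≤ M) ∨
        ∃ L₁ x L₂, L = L₁ ++ x :: L₂ ∧
          2 * (A ∩ L₂.toFinset).card ≤ M ∧ 2 * (B ∩ L₂.toFinset).card ≤ M ∧
          (M < 2 * (A ∩ (x :: L₂).toFinset).card ∨ M < 2 * (B ∩ (x :: L₂).toFinset).card) := by
      intro L
      induction L with
      | nil => left; simp
      | cons y L ihL =>
        rcases ihL with h | ⟨L₁, x, L₂, rfl, h⟩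
        · by_cases h' : 2 * (A ∩ (y :: L).toFinset).card ≤ M ∧
            2 * (B ∩ (y :: L).toFinset).card ≤ M
          · exact .inl h'
          · exact .inr ⟨[], y, L, rfl, h.1, h.2, by omega⟩
        · exact .inr ⟨y :: L₁, x, L₂, rfl, h⟩
    have hmem : ∀ (C : Finset V) (x : V) (L₂ : List V), 2 * (C ∩ L₂.toFinset).card ≤ M →
        M < 2 * (C ∩ (x :: L₂).toFinset).card → x ∈ C := by
      intro C x L₂ h1 h2
      by_contra hx
      rw [List.toFinset_cons, Finset.inter_insert_of_notMem hx] at h2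
      omega
    rcases hcross L with ⟨h1, h2⟩ | ⟨L₁, x, L₂, rfl, h1, h2, h3 | h3⟩
    · have hle : ∀ C : Finset V, M ≤ C.card → 2 * (C ∩ L.toFinset).card ≤ M →
          M ≤ 2 ^ (t + 1) * (C \ L.toFinset).card := by
        intro C hC h
        have h1 := Finset.card_sdiff_add_card_inter C L.toFinset
        calc M ≤ 2 * (C \ L.toFinset).card := by omega
          _ ≤ 2 ^ (t + 1) * (C \ L.toFinset).card := by
            gcongr; rw [pow_succ]; have := Nat.one_le_two_pow (n := t); omega
      refine ⟨A \ L.toFinset, Finset.sdiff_subset, B \ L.toFinset, Finset.sdiff_subset,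
        hle A hA h1, hle B hB h2, [L], by simp, by simp, ?_⟩
      simp only [List.mem_singleton, forall_eq]
      left
      intro u hu
      rw [Finset.mem_sdiff, List.mem_toFinset] at hu
      exact hu.2
    · have hx := hmem A x L₂ h1 h3
      obtain ⟨a, rfl⟩ : ∃ a', a = a' + 1 := Nat.exists_eq_succ_of_ne_zero (by
        have := ha x hx
        simp at this
        omega)
      exact step a b hab L₁ L₂ x A B M hd hx hB ha hb h3 h2
    · have hx := hmem B x L₂ h2 h3
      obtain ⟨b, rfl⟩ : ∃ b', b = b' + 1 := Nat.exists_eq_succ_of_ne_zero (by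
        have := hb x hx
        simp at this
        omega)
      obtain ⟨B', hB', A', hA', h4, h5, Ls, h6, h7, h8⟩ :=
        step b a (by omega) L₁ L₂ x B A M hd.symm hx hA hb ha h3 h1
      exact ⟨A', hA', B', hB', h5, h4, Ls, h6, h7, fun S hS => (h8 S hS).symm⟩

namespace NBP

variable {V : Type*} {G : SimpleGraph V} {Z : NBP (GVar G)}

theorem exists_split_of_sublist {S T : List V} : ∀ {p : List Z.E},
    (Z.vertexSeq p).Sublist (S ++ T) →
    ∃ q r, p = q ++ r ∧ (Z.vertexSeq q).Sublist S ∧ (Z.vertexSeq r).Sublist T := by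
  intro p h
  obtain ⟨l₁, l₂, h1, h2, h3⟩ := List.sublist_append_iff.1 h
  obtain ⟨m₁, m₂, h4, h5, h6⟩ := List.filterMap_eq_append_iff.1 h1
  obtain ⟨q, r, h7, h8, h9⟩ := List.filterMap_eq_append_iff.1 h4
  refine ⟨q, r, h7, ?_, ?_⟩
  · rwa [vertexSeq, lits, h8, h5]
  · rwa [vertexSeq, lits, h9, h6]

/-- A family of paths whose vertex sequences follow the same list of segments, each avoiding `U`
or `W`, contains a large subfamily that can be mixed along `U` and `W`. -/
theorem exists_mixing_of_segments {ι : Type*} {U W : Finset V} {v : Z.V} (Ls : List (List V))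
    (hLs : ∀ S ∈ Ls, (∀ u ∈ U, u ∉ S) ∨ (∀ u ∈ W, u ∉ S)) :
    ∀ (x : Z.V) (I : Finset ι) (f : ι → List Z.E),
      (∀ i ∈ I, IsPath Z.src Z.tgt x v (f i)) →
      (∀ i ∈ I, (Z.vertexSeq (f i)).Sublist Ls.flatten) →
      ∃ I' ⊆ I, I.card ≤ I'.card * Z.size ^ Ls.length ∧ ∀ i ∈ I', ∀ j ∈ I', ∃ r,
        IsPath Z.src Z.tgt x v r ∧ Z.Mixes U W (f i) (f j) r := by
  induction Ls with
  | nil =>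
    intro x I f hf hs
    refine ⟨I, subset_rfl, by simp, fun i hi j _ => ⟨f i, hf i hi, .of_notMem_right _ ?_⟩⟩
    have := hs i hi
    simp only [List.flatten_nil, List.sublist_nil] at this
    simp [this]
  | cons S Ls ih =>
    intro x I f hf hs
    -- Each path is cut where it finishes the segment `S`; paths cut at the same program vertex `y`
    -- can exchange their prefixes.
    have key : ∀ i, ∃ (y : Z.V) (p q : List Z.E), i ∈ I → f i = p ++ q ∧
        IsPath Z.src Z.tgt x y p ∧ IsPath Z.src Z.tgt y v q ∧ (Z.vertexSeq p).Sublist S ∧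
        (Z.vertexSeq q).Sublist Ls.flatten := by
      intro i
      by_cases hi : i ∈ I
      · obtain ⟨p, q, hpq, hp, hq⟩ := exists_split_of_sublist
          (List.flatten_cons ▸ hs i hi)
        obtain ⟨y, h1, h2⟩ := IsPath.exists_of_append (hpq ▸ hf i hi)
        exact ⟨y, p, q, fun _ => ⟨hpq, h1, h2, hp, hq⟩⟩
      · exact ⟨x, [], [], fun h => absurd h hi⟩
    choose g p q hg using key
    let _ := Z.finV
    classical
    have : Nonempty Z.V := ⟨x⟩
    obtain ⟨y, hy⟩ := exists_card_le_card_fiber_mul I g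
    obtain ⟨I', hI', hc, hm⟩ := ih (fun S hS => hLs S (List.mem_cons_of_mem _ hS)) y
      (I.filter fun i => g i = y) q
      (fun i hi => by
        rw [Finset.mem_filter] at hi
        exact hi.2 ▸ (hg i hi.1).2.2.1)
      (fun i hi => (hg i (Finset.mem_filter.1 hi).1).2.2.2.2)
    refine ⟨I', hI'.trans (Finset.filter_subset _ _), ?_, fun i hi j hj => ?_⟩
    · calc I.card ≤ (I.filter fun i => g i = y).card * Z.size := hy
        _ ≤ I'.card * Z.size ^ Ls.length * Z.size := by gcongr
        _ = I'.card * Z.size ^ (S :: Ls).length := by rw [List.length_cons]; ring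
    · obtain ⟨r, hr, hmix⟩ := hm i hi j hj
      have hi' := Finset.mem_filter.1 (hI' hi)
      have hj' := Finset.mem_filter.1 (hI' hj)
      obtain ⟨ei, pi, -, si, -⟩ := hg i hi'.1
      obtain ⟨ej, pj, -, sj, -⟩ := hg j hj'.1
      rw [hi'.2] at pi
      rw [hj'.2] at pj
      rw [ei, ej]
      -- If `S` avoids `U`, the prefix is taken from the second path; if it avoids `W`, from the
      -- first.
      rcases hLs S List.mem_cons_self with h | h
      · exact ⟨p j ++ r, pj.append hr,
          (Mixes.of_notMem_right _ fun u hu hu' => h u hu (sj.subset hu')).symm.append hmix⟩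
      · exact ⟨p i ++ r, pi.append hr,
          (Mixes.of_notMem_right _ fun u hu hu' => h u hu (si.subset hu')).append hmix⟩

end NBP
end BranchingPrograms

/-! ### Families without bad pairs, and bounds for the two program classes -/

namespace BranchingPrograms

theorem eq_of_inter_eq {V : Type*} [DecidableEq V] {U W C D : Finset V}
    (hR : C \ (U ∪ W) = D \ (U ∪ W)) (hU : C ∩ U = D ∩ U) (hW : C ∩ W = D ∩ W) : C = D := by
  ext x
  have h1 := Finset.ext_iff.1 hR x
  have h2 := Finset.ext_iff.1 hU x
  have h3 := Finset.ext_iff.1 hW x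
  simp only [Finset.mem_sdiff, Finset.mem_union, Finset.mem_inter] at h1 h2 h3
  tauto

/-- A family of sets in which, for members with the same trace outside `U ∪ W`, the traces on `U`
and on `W` never disagree in opposite directions, is small. -/
theorem card_mul_two_pow_le {V : Type*} [Fintype V] [DecidableEq V] {U W : Finset V} {m : ℕ}
    (hUW : Disjoint U W) (hU : U.card = m) (hW : W.card = m) (F : Finset (Finset V))
    (hF : ∀ C ∈ F, ∀ D ∈ F, C \ (U ∪ W) = D \ (U ∪ W) → D ∩ U ⊆ C ∨ C ∩ W ⊆ D) :
    F.card * 2 ^ m ≤ 2 ^ Fintype.card V * (m + 2) := by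
  classical
  set R := (U ∪ W)ᶜ with hR
  have hsR : ∀ C : Finset V, C \ (U ∪ W) ∈ R.powerset := fun C => by
    rw [Finset.mem_powerset, Finset.sdiff_eq_inter_compl]
    exact Finset.inter_subset_right
  have hn : R.card + m + m = Fintype.card V := by
    have h1 := Finset.card_add_card_compl (U ∪ W)
    rw [← hR, Finset.card_union_of_disjoint hUW, hU, hW] at h1
    omega
  -- `P C` says that some member of `F` differs from `C` only on `W`. Members violating `P` are
  -- determined by their traces off `W`.
  let P : Finset V → Prop := fun C =>
    ∃ D ∈ F, D \ (U ∪ W) = C \ (U ∪ W) ∧ D ∩ U = C ∩ U ∧ D ∩ W ≠ C ∩ W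
  have h0 : (F.filter P).card ≤ 2 ^ R.card * ((m + 1) * 2 ^ m) := by
    have : (F.filter P).card ≤
        (R.powerset ×ˢ (Finset.range (m + 1) ×ˢ W.powerset)).card := by
      refine Finset.card_le_card_of_injOn
        (fun C => (C \ (U ∪ W), (C ∩ U).card, C ∩ W)) ?_ ?_
      · intro C _
        simp only [Finset.coe_product, Set.mem_prod, Finset.mem_coe]
        refine ⟨hsR C, ?_, ?_⟩
        · rw [Finset.mem_range, Nat.lt_succ_iff, ← hU]
          exact Finset.card_le_card Finset.inter_subset_right
        · exact Finset.mem_powerset.2 Finset.inter_subset_right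
      · intro C hC C' hC' h
        simp only [Prod.mk.injEq] at h
        obtain ⟨h1, h2, h3⟩ := h
        obtain ⟨hCF, D, hD, hD1, hD2, hD3⟩ := Finset.mem_filter.1 hC
        have hC'F := (Finset.mem_filter.1 hC').1
        refine eq_of_inter_eq h1 ?_ h3
        -- Using both orders of `D` and `C'`, either their traces on `U` are comparable, hence equal
        -- by cardinality, or those on `W` coincide, which the choice of `D` excludes. So the traces
        -- on `U` of members satisfying `P`, with the other data fixed, are separated by their
        -- cardinalities.
        have e1 := hF D hD C' hC'F (hD1.trans h1)
        have e2 := hF C' hC'F D hD (hD1.trans h1).symm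
        rcases e1 with e1 | e1
        · refine (Finset.eq_of_subset_of_card_le ?_ h2.le).symm
          rw [← hD2]
          exact Finset.subset_inter e1 Finset.inter_subset_right
        · rcases e2 with e2 | e2
          · refine Finset.eq_of_subset_of_card_le ?_ h2.ge
            rw [← hD2]
            exact Finset.subset_inter e2 Finset.inter_subset_right
          · exact absurd (Finset.Subset.antisymm (Finset.subset_inter e1 Finset.inter_subset_right)
              (Finset.subset_inter e2 Finset.inter_subset_right)) (h3 ▸ hD3)
    simpa [Finset.card_product, hW] using this
  have h1 : (F.filter fun C => ¬ P C).card ≤ 2 ^ R.card * 2 ^ m := by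
    have : (F.filter fun C => ¬ P C).card ≤ (R.powerset ×ˢ U.powerset).card := by
      refine Finset.card_le_card_of_injOn (fun C => (C \ (U ∪ W), C ∩ U)) ?_ ?_
      · intro C _
        simp only [Finset.coe_product, Set.mem_prod, Finset.mem_coe]
        exact ⟨hsR C, Finset.mem_powerset.2 Finset.inter_subset_right⟩
      · intro C hC C' hC' h
        simp only [Prod.mk.injEq] at h
        refine eq_of_inter_eq h.1 h.2 ?_
        by_contra hne
        exact (Finset.mem_filter.1 hC').2 ⟨C, (Finset.mem_filter.1 hC).1, h.1, h.2, hne⟩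
    simpa [Finset.card_product, hU] using this
  have h2 := Finset.card_filter_add_card_filter_not (s := F) P
  calc F.card * 2 ^ m ≤ (2 ^ R.card * ((m + 1) * 2 ^ m) + 2 ^ R.card * 2 ^ m) * 2 ^ m := by
        gcongr; omega
    _ = 2 ^ (R.card + m + m) * (m + 2) := by ring
    _ = 2 ^ Fintype.card V * (m + 2) := by rw [hn]

theorem exists_disjoint_halves (n : ℕ) : ∃ A B : Finset (Fin n), Disjoint A B ∧
    n / 2 ≤ A.card ∧ n / 2 ≤ B.card := by
  obtain ⟨A, -, hA⟩ := Finset.exists_subset_card_eq (s := (Finset.univ : Finset (Fin n)))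
    (n := n / 2) (by simp; omega)
  refine ⟨A, Aᶜ, disjoint_compl_right, hA.ge, ?_⟩
  rw [Finset.card_compl, hA, Fintype.card_fin]
  omega

namespace NBP

theorem Computes.exists_path {X : Type*} {Z : NBP X} {φ : CNF X} (h : Z.Computes φ) {τ : X → Bool}
    (hτ : Satisfies (assignmentLits τ) φ) :
    ∃ p, Z.IsComputational p ∧ ∀ l ∈ Z.lits p, τ l.1 = l.2 :=
  (h τ).1 hτ

theorem satisfies_graphCNF_iff {V : Type*} {G : SimpleGraph V} {τ : GVar G → Bool} :
    Satisfies (assignmentLits τ) (graphCNF G) ↔ ∀ u v (h : G.Adj u v), τ (.vertex u) = true ∨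
      τ (.edge ⟨s(u, v), G.mem_edgeSet.2 h⟩) = true ∨ τ (.vertex v) = true := by
  constructor
  · intro h u v huv
    obtain ⟨l, hl, hl'⟩ := h _ ⟨u, v, huv, rfl⟩
    rcases hl with rfl | rfl | rfl
    · exact .inl hl'
    · exact .inr (.inl hl')
    · exact .inr (.inr hl')
  · rintro h _ ⟨u, v, huv, rfl⟩
    rcases h u v huv with h | h | h
    · exact ⟨_, .inl rfl, h⟩
    · exact ⟨_, .inr (.inl rfl), h⟩
    · exact ⟨_, .inr (.inr rfl), h⟩

open Classical in
/-- The assignment that makes true the vertices of `C` and the edges outside `C`. -/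
noncomputable def coverAssignment {V : Type*} [DecidableEq V] (G : SimpleGraph V) (C : Finset V) : GVar G → Bool
  | .vertex u => decide (u ∈ C)
  | .edge e => decide (∀ u ∈ (e : Sym2 V), u ∉ C)

theorem satisfies_coverAssignment {V : Type*} [DecidableEq V] (G : SimpleGraph V) (C : Finset V) :
    Satisfies (assignmentLits (coverAssignment G C)) (graphCNF G) := by
  rw [satisfies_graphCNF_iff]
  intro u v huv
  simp only [coverAssignment, decide_eq_true_eq, Sym2.mem_iff]
  by_cases hu : u ∈ C
  · exact .inl hu
  · by_cases hv : v ∈ C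
    · exact .inr (.inr hv)
    · right; left; rintro w (rfl | rfl) <;> assumption

theorem IsVEMBP.exists_le {n k : ℕ} {Z : NBP (GVar (⊤ : SimpleGraph (Fin n)))}
    (hZ : Z.IsVEMBP k) (hc : Z.Computes (graphCNF (⊤ : SimpleGraph (Fin n)))) :
    ∃ m : ℕ, n ≤ 2 * 4 ^ k * (m + 2) ∧
      2 ^ m ≤ (2 * (n + 1) * Z.size ^ 2) ^ (2 * k) * (m + 2) := by
  classical
  obtain ⟨A, B, hAB, hA, hB⟩ := exists_disjoint_halves n
  choose f hf hτ using fun C : Finset (Fin n) => hc.exists_path (satisfies_coverAssignment ⊤ C)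
  obtain ⟨I, -, A', hA', B', hB', h1, h2, h3, h4⟩ :=
    mixesFamilies (Z := Z) (Finset (Fin n)) (2 * k) k k (by ring) Z.leaf A B (n / 2)
      Finset.univ f hA hB (fun p hp u _ => (hZ p hp).1 u) (fun p hp u _ => (hZ p hp).1 u)
      (fun C _ => (hf C).1)
  obtain ⟨m, hm, hmA, hmB⟩ : ∃ m, n / 2 + 2 ≤ 2 ^ (2 * k) * (m + 2) ∧ m ≤ A'.card ∧ m ≤ B'.card := by
    rcases le_total A'.card B'.card with h | h
    · exact ⟨A'.card, h1, le_rfl, h⟩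
    · exact ⟨B'.card, h2, h, le_rfl⟩
  obtain ⟨U, hU, hUm⟩ := Finset.exists_subset_card_eq hmA
  obtain ⟨W, hW, hWm⟩ := Finset.exists_subset_card_eq hmB
  have hUW : Disjoint U W := hAB.mono (hU.trans hA') (hW.trans hB')
  have key := card_mul_two_pow_le hUW hUm hWm I (by
    intro C hC D hD hCD
    by_contra! hcon
    obtain ⟨hcu, hcw⟩ := hcon
    obtain ⟨u, hu, huC⟩ := Finset.not_subset.1 hcu
    obtain ⟨w, hw, hwD⟩ := Finset.not_subset.1 hcw
    obtain ⟨huD, huU⟩ := Finset.mem_inter.1 hu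
    obtain ⟨hwC, hwW⟩ := Finset.mem_inter.1 hw
    obtain ⟨r, hr, hmix⟩ := h4 C hC D hD
    have hmix := hmix.mono hU hW
    -- Only positive edge literals occur, so the disjunction of the two edge assignments verifies
    -- those of both paths. Off `U ∪ W` the sets `C` and `D` agree, so either may be used there.
    let τ : GVar (⊤ : SimpleGraph (Fin n)) → Bool
      | .vertex x => if x ∈ W then decide (x ∈ D) else decide (x ∈ C)
      | .edge e => coverAssignment ⊤ C (.edge e) || coverAssignment ⊤ D (.edge e)
    have hsat := hc.satisfies (τ := τ) hr (by
      rintro ⟨x | e, b⟩ hl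
      · change τ (.vertex x) = b
        simp only [τ]
        by_cases hxW : x ∈ W
        · rw [if_pos hxW]
          simpa [coverAssignment] using hτ D _ (hmix.right x hxW b hl)
        · rw [if_neg hxW]
          rcases hmix.sub _ hl with h | h
          · simpa [coverAssignment] using hτ C _ h
          · by_cases hxU : x ∈ U
            · simpa [coverAssignment] using hτ C _ (hmix.left x hxU b hl)
            · have h5 : decide (x ∈ D) = b := by
                simpa [coverAssignment] using hτ D _ h
              rw [← h5, decide_eq_decide]
              have := Finset.ext_iff.1 hCD x
              simpa [hxU, hxW] using this
      · cases b with
        | false => exact absurd hl ((hZ r hr).2 e)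
        | true =>
          change τ (.edge e) = true
          simp only [τ, Bool.or_eq_true]
          exact (hmix.sub _ hl).imp (hτ C _) (hτ D _))
    rw [satisfies_graphCNF_iff] at hsat
    have huW : u ∉ W := Finset.disjoint_left.1 hUW huU
    have huw : u ≠ w := by rintro rfl; exact huW hwW
    have := hsat u w huw
    simp only [τ, if_neg huW, if_pos hwW, decide_eq_true_eq, huC, hwD, or_false, false_or,
      coverAssignment, Bool.or_eq_true, Sym2.mem_iff] at this
    rcases this with h | h
    · exact h w (.inr rfl) hwC
    · exact h u (.inl rfl) huD)
  refine ⟨m, ?_, ?_⟩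
  · rw [pow_mul] at hm
    norm_num at hm
    rw [mul_assoc]
    omega
  · simp only [Finset.card_univ, Fintype.card_finset, Fintype.card_fin] at h3 key
    set N := (2 * (n + 1) * Z.size ^ 2) ^ (2 * k) with hN
    refine Nat.le_of_mul_le_mul_left ?_ (Nat.two_pow_pos n)
    calc 2 ^ n * 2 ^ m ≤ I.card * N * 2 ^ m := by gcongr
      _ = N * (I.card * 2 ^ m) := by ring
      _ ≤ N * (2 ^ n * (m + 2)) := by gcongr
      _ = 2 ^ n * (N * (m + 2)) := by ring

open Classical in
/-- For a matching `u ↦ g u` of `U`: the assignment that makes false exactly the edges of the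
matching, the vertices of `U` outside `T`, and the vertices matched with vertices of `S`. -/
noncomputable def matchingAssignment {V : Type*} (G : SimpleGraph V) (U : Finset V) (g : V → V)
    (T S : Finset V) : GVar G → Bool
  | .vertex v => if v ∈ U then decide (v ∈ T) else decide (∀ u ∈ S, g u ≠ v)
  | .edge e => decide (∀ u ∈ U, (e : Sym2 V) ≠ s(u, g u))

theorem IsVOBP.exists_le {n k : ℕ} {Z : NBP (GVar (⊤ : SimpleGraph (Fin n)))} (hn : 2 ≤ n)
    (hZ : Z.IsVOBP k) (hc : Z.Computes (graphCNF (⊤ : SimpleGraph (Fin n)))) :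
    ∃ m : ℕ, n ≤ 4 * 4 ^ k * m ∧ 2 ^ m ≤ Z.size ^ (2 * k + 1) := by
  classical
  obtain ⟨A, B, hAB, hA, hB⟩ := exists_disjoint_halves n
  obtain ⟨-, L, hL, hsub⟩ := hZ
  obtain ⟨A', hA', B', hB', h1, h2, Ls, rfl, hlen, hLs⟩ :=
    exists_segments (2 * k) k k (by ring) L A B (n / 2) hAB hA hB
      (fun u _ => (hL u).le) (fun u _ => (hL u).le)
  obtain ⟨m, hm, hmA, hmB⟩ : ∃ m, n / 2 ≤ 2 ^ (2 * k) * m ∧ m ≤ A'.card ∧ m ≤ B'.card := by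
    rcases le_total A'.card B'.card with h | h
    · exact ⟨A'.card, h1, le_rfl, h⟩
    · exact ⟨B'.card, h2, h, le_rfl⟩
  obtain ⟨U, hU, hUm⟩ := Finset.exists_subset_card_eq hmA
  obtain ⟨W, hW, hWm⟩ := Finset.exists_subset_card_eq hmB
  have hUW : Disjoint U W := hAB.mono (hU.trans hA') (hW.trans hB')
  have hLs : ∀ S ∈ Ls, (∀ u ∈ U, u ∉ S) ∨ (∀ u ∈ W, u ∉ S) := fun S hS =>
    (hLs S hS).imp (fun h u hu => h u (hU hu)) (fun h u hu => h u (hW hu))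
  obtain ⟨g, hgW, hginj⟩ : ∃ g : Fin n → Fin n, (∀ u ∈ U, g u ∈ W) ∧ Set.InjOn g U := by
    let e := Finset.equivOfCardEq (hUm.trans hWm.symm)
    refine ⟨fun u => if h : u ∈ U then e ⟨u, h⟩ else u, fun u hu => by simp [hu], ?_⟩
    intro u hu u' hu' h
    simp only [Finset.mem_coe] at hu hu'
    simpa [hu, hu', Subtype.coe_inj] using h
  have hgU : ∀ u ∈ U, g u ∉ U := fun u hu h => Finset.disjoint_left.1 hUW h (hgW u hu)
  have hex : ∀ S : Finset (Fin n), ∃ p, S ∈ U.powerset → Z.IsComputational p ∧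
      ∀ l ∈ Z.lits p, matchingAssignment ⊤ U g S S l.1 = l.2 := by
    intro S
    by_cases hS : S ∈ U.powerset
    · obtain ⟨p, hp⟩ := hc.exists_path (τ := matchingAssignment ⊤ U g S S) (by
        rw [satisfies_graphCNF_iff]
        have hmatch : ∀ u ∈ U, u ∈ S ∨ ∀ u' ∈ S, g u' ≠ g u := by
          intro u hu
          by_cases huS : u ∈ S
          · exact .inl huS
          · refine .inr fun u' hu' h => huS ?_
            rwa [← hginj (Finset.mem_powerset.1 hS hu') hu h]
        intro u v huv
        by_cases he : ∀ x ∈ U, s(u, v) ≠ s(x, g x)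
        · exact .inr (.inl (by simpa only [matchingAssignment, decide_eq_true_eq] using he))
        · push Not at he
          obtain ⟨x, hx, he⟩ := he
          have hx' := hmatch x hx
          rcases Sym2.eq_iff.1 he with ⟨rfl, rfl⟩ | ⟨rfl, rfl⟩
          · refine hx'.imp (fun h => ?_) (fun h => .inr ?_)
            · simpa [matchingAssignment, hx] using h
            · simpa [matchingAssignment, hgU _ hx] using h
          · refine hx'.symm.imp (fun h => ?_) (fun h => .inr ?_)
            · simpa [matchingAssignment, hgU _ hx] using h
            · simpa [matchingAssignment, hx] using h)
      exact ⟨p, fun _ => hp⟩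
    · exact ⟨[], fun h => absurd h hS⟩
  choose f hf using hex
  obtain ⟨I, hI, h3, h4⟩ := exists_mixing_of_segments (v := Z.leaf) Ls hLs Z.root U.powerset f
    (fun S hS => (hf S hS).1.1) (fun S hS => hsub _ (hf S hS).1)
  have hle : ∀ S ∈ I, ∀ T ∈ I, T ⊆ S := by
    intro S hS T hT u huT
    have hu : u ∈ U := Finset.mem_powerset.1 (hI hT) huT
    obtain ⟨r, hr, hmix⟩ := h4 S hS T hT
    have hsat := hc.satisfies (τ := matchingAssignment ⊤ U g S T) hr (by
      rintro ⟨x | e, b⟩ hl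
      · change matchingAssignment ⊤ U g S T (.vertex x) = b
        by_cases hxU : x ∈ U
        · have := (hf S (hI hS)).2 _ (hmix.left x hxU b hl)
          simpa [matchingAssignment, hxU] using this
        · by_cases hxW : x ∈ W
          · have := (hf T (hI hT)).2 _ (hmix.right x hxW b hl)
            simpa [matchingAssignment, hxU] using this
          -- Vertices outside `U ∪ W` are true in every assignment of the family, so literals from
          -- either path are compatible there.
          · have hfree : ∀ S' ∈ U.powerset, matchingAssignment (⊤ : SimpleGraph (Fin n)) U g S' S'
                (.vertex x) = matchingAssignment ⊤ U g S T (.vertex x) := by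
              intro S' hS'
              have h5 : ∀ S'' ∈ U.powerset, ∀ u ∈ S'', g u ≠ x := by
                rintro S'' hS'' u hu rfl
                exact hxW (hgW u (Finset.mem_powerset.1 hS'' hu))
              simp only [matchingAssignment, if_neg hxU, decide_eq_decide]
              exact ⟨fun _ => h5 T (hI hT), fun _ => h5 S' hS'⟩
            rcases hmix.sub _ hl with h | h
            · rw [← hfree S (hI hS)]; exact (hf S (hI hS)).2 _ h
            · rw [← hfree T (hI hT)]; exact (hf T (hI hT)).2 _ h
      · change matchingAssignment ⊤ U g S T (.edge e) = b
        rcases hmix.sub _ hl with h | h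
        · exact (hf S (hI hS)).2 _ h
        · exact (hf T (hI hT)).2 _ h)
    rw [satisfies_graphCNF_iff] at hsat
    have hne : u ≠ g u := fun h => hgU u hu (h ▸ hu)
    rcases hsat u (g u) hne with h | h | h
    · simpa [matchingAssignment, hu] using h
    · simp only [matchingAssignment, decide_eq_true_eq] at h
      exact absurd rfl (h u hu)
    · simp only [matchingAssignment, if_neg (hgU u hu), decide_eq_true_eq] at h
      exact absurd rfl (h u huT)
  have hI1 : I.card ≤ 1 := Finset.card_le_one.2 fun S hS T hT =>
    Finset.Subset.antisymm (hle T hT S hS) (hle S hS T hT)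
  refine ⟨m, ?_, ?_⟩
  · rw [pow_mul] at hm
    norm_num at hm
    rw [mul_assoc]
    omega
  · rw [Finset.card_powerset, hUm] at h3
    calc 2 ^ m ≤ I.card * Z.size ^ Ls.length := h3
      _ ≤ 1 * Z.size ^ (2 * k + 1) := by
        gcongr
        exact Z.size_pos
      _ = Z.size ^ (2 * k + 1) := one_mul _

/-- A program computing the CNF of a graph with an edge has at least two vertices. -/
theorem two_le_size {V : Type*} {G : SimpleGraph V} {Z : NBP (GVar G)}
    (hc : Z.Computes (graphCNF G)) {u v : V} (huv : G.Adj u v) : 2 ≤ Z.size := by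
  let _ := Z.finV
  by_contra! h
  have hsub : Subsingleton Z.V := Fintype.card_le_one_iff_subsingleton.1 (by
    have : Fintype.card Z.V < 2 := h
    omega)
  have hpath : Z.IsRootLeafPath [] := by
    rw [IsRootLeafPath, hsub.elim Z.leaf Z.root]
    exact .nil _
  have := hc.satisfies (τ := fun _ => false) hpath (by simp [lits])
  rw [satisfies_graphCNF_iff] at this
  simpa using this u v huv

end NBP
end BranchingPrograms

/-! ### Numerical estimates -/

namespace BranchingPrograms

/-- With `y = m + 2` and `l = log₂ z`, taking logarithms bounds `y` by `4 * k * l` plus polynomial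
terms in `k` and terms in `log₂ y`. For large `y` these extra terms are absorbed, leaving `y ≤ 32 *
k * l`. -/
theorem rpow_le_of_vembp_bound {k n m z : ℕ} (hz : 2 ≤ z) (hn : n ≤ 2 * 4 ^ k * (m + 2))
    (hm : 2 ^ m ≤ (2 * (n + 1) * z ^ 2) ^ (2 * k) * (m + 2)) (hn2 : 2 ≤ n) :
    (2 : ℝ) ^ ((n : ℝ) / (2 ^ (8 * k + 10) * (8 * k + 9))) ≤ z := by
  have hz0 : (0 : ℝ) < z := by positivity
  rw [← Real.le_logb_iff_rpow_le (by norm_num) hz0]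
  set l := Real.logb 2 z with hl
  have hl1 : 1 ≤ l := by
    rw [hl, Real.le_logb_iff_rpow_le (by norm_num) hz0]
    simpa using (by exact_mod_cast hz : (2 : ℝ) ≤ z)
  have hD : (0 : ℝ) < 2 ^ (8 * k + 10) * (8 * k + 9) := by positivity
  -- An exponent at most `1` is settled by `z ≥ 2`. Otherwise `n` is at least the denominator, which
  -- makes `y` large in terms of `k`.
  rcases le_total ((n : ℝ) / (2 ^ (8 * k + 10) * (8 * k + 9))) 1 with h1 | h1
  · exact h1.trans hl1
  rw [one_le_div hD] at h1
  rw [div_le_iff₀ hD]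
  have hlog1 : ∀ x : ℝ, 0 < x → Real.logb 2 x ≤ x := by
    intro x hx
    rcases le_total x 1 with h | h
    · exact (Real.logb_nonpos (by norm_num) hx.le h).trans hx.le
    · rw [Real.logb_le_iff_le_rpow (by norm_num) hx]
      have h2 : (x : ℝ) ≤ 2 ^ x := by
        have h4 := one_add_mul_self_le_rpow_one_add (s := 1) (by norm_num) h
        norm_num at h4
        linarith
      exact h2
  set y : ℝ := (m : ℝ) + 2 with hy
  have hy0 : 0 < y := by positivity
  have hnR : (n : ℝ) ≤ 2 * 4 ^ k * y := by
    rw [hy]; exact_mod_cast hn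
  have hmR : (2 : ℝ) ^ m ≤ (2 * (n + 1) * z ^ 2) ^ (2 * k) * y := by
    rw [hy]; exact_mod_cast hm
  have hn0 : (0 : ℝ) < n := by positivity
  have hlogm : (m : ℝ) ≤ 2 * k * (1 + Real.logb 2 (n + 1) + 2 * l) + Real.logb 2 y := by
    have h2 := Real.logb_le_logb_of_le (b := 2) (by norm_num) (by positivity) hmR
    rw [Real.logb_pow, Real.logb_self_eq_one (by norm_num), Real.logb_mul (by positivity)
      (by positivity), Real.logb_pow, Real.logb_mul (by positivity) (by positivity),
      Real.logb_mul (by positivity) (by positivity), Real.logb_pow,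
      Real.logb_self_eq_one (by norm_num)] at h2
    push_cast at h2
    linarith
  have hlogn : Real.logb 2 ((n : ℝ) + 1) ≤ 2 + 2 * k + Real.logb 2 y := by
    have h2 : (n : ℝ) + 1 ≤ 2 ^ (2 + 2 * k) * y := by
      have h3 : (2 : ℝ) ^ (2 + 2 * k) = 4 * 4 ^ k := by
        rw [pow_add, pow_mul]; norm_num
      have h5 : (2 : ℝ) ≤ n := by exact_mod_cast hn2
      rw [h3]; linarith
    have h3 := Real.logb_le_logb_of_le (b := 2) (by norm_num) (by positivity) h2
    rw [Real.logb_mul (by positivity) (by positivity), Real.logb_pow,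
      Real.logb_self_eq_one (by norm_num)] at h3
    push_cast at h3
    linarith
  have hlogy : ∀ j : ℕ, Real.logb 2 y ≤ y / 2 ^ j + j := by
    intro j
    have h2 := hlog1 (y / 2 ^ j) (by positivity)
    rw [Real.logb_div (by positivity) (by positivity), Real.logb_pow,
      Real.logb_self_eq_one (by norm_num)] at h2
    linarith
  have hybig : (2 : ℝ) ^ (6 * k) * (512 * (8 * k + 9)) ≤ y := by
    have h2 := h1.trans hnR
    have h3 : (2 : ℝ) ^ (8 * k + 10) = 4 ^ k * (2 ^ (6 * k) * 1024) := by
      rw [show (4 : ℝ) = 2 ^ 2 by norm_num, ← pow_mul, ← mul_assoc, ← pow_add, pow_add]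
      congr 1
      · congr 1; ring
      · norm_num
    rw [h3] at h2
    have h4 : (0 : ℝ) < 4 ^ k := by positivity
    nlinarith
  have hk1 : (1 : ℝ) + 3 * k ≤ 2 ^ (6 * k) := by
    have h2 := one_add_mul_le_pow (a := (1 : ℝ)) (by norm_num) (6 * k)
    push_cast at h2
    norm_num at h2
    have : (0 : ℝ) ≤ k := by positivity
    linarith
  have hk0 : (0 : ℝ) ≤ k := by positivity
  have hlogyk : 2 * k * Real.logb 2 y ≤ y / 4 + 2 * k * (k + 3) := by
    -- The shift `k + 3` makes the coefficient `2 * k / 2 ^ (k + 3)` at most `1 / 4`.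
    have h2 := hlogy (k + 3)
    push_cast at h2
    have h3 : 2 * (k : ℝ) * (y / 2 ^ (k + 3)) ≤ y / 4 := by
      have h4 : (k : ℝ) ≤ 2 ^ k := by exact_mod_cast Nat.lt_two_pow_self.le
      rw [pow_add, mul_div_assoc', div_le_div_iff₀ (by positivity) (by positivity)]
      nlinarith
    have h5 := mul_le_mul_of_nonneg_left h2 (by positivity : (0 : ℝ) ≤ 2 * k)
    linarith
  have hlogy2 := hlogy 2
  norm_num at hlogy2
  have hsum : y / 2 ≤ 4 + 2 * k * (3 + 2 * k) + (y / 4 + 2 * k * (k + 3)) + 4 * k * l := by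
    have h2 := mul_le_mul_of_nonneg_left hlogn (by positivity : (0 : ℝ) ≤ 2 * k)
    have h3 : y = m + 2 := hy
    nlinarith
  have hpoly : 4 + 2 * (k : ℝ) * (3 + 2 * k) + 2 * k * (k + 3) ≤ y / 8 := by
    have : (1 + 3 * (k : ℝ)) * (512 * (8 * k + 9)) ≤ y :=
      (mul_le_mul_of_nonneg_right hk1 (by positivity)).trans hybig
    nlinarith
  have hfin : y ≤ 32 * k * l := by linarith
  have h2k : (2 : ℝ) ^ (8 * k + 10) = 4 ^ k * (2 ^ (6 * k) * 1024) := by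
    rw [show (4 : ℝ) = 2 ^ 2 by norm_num, ← pow_mul, ← mul_assoc, ← pow_add, pow_add]
    congr 1
    · congr 1; ring
    · norm_num
  calc (n : ℝ) ≤ 2 * 4 ^ k * y := hnR
    _ ≤ 2 * 4 ^ k * (32 * k * l) := by gcongr
    _ = 4 ^ k * (l * (64 * k)) := by ring
    _ ≤ 4 ^ k * (l * (2 ^ (6 * k) * 1024 * (8 * k + 9))) := by
      have : (1 : ℝ) ≤ 2 ^ (6 * k) := by linarith
      gcongr <;> linarith
    _ = l * (2 ^ (8 * k + 10) * (8 * k + 9)) := by rw [h2k]; ring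

theorem rpow_le_of_vobp_bound {k n m z : ℕ} (hz : 2 ≤ z) (hn : n ≤ 4 * 4 ^ k * m)
    (hm : 2 ^ m ≤ z ^ (2 * k + 1)) :
    (2 : ℝ) ^ ((n : ℝ) / (2 ^ (8 * k + 10) * (8 * k + 9))) ≤ z := by
  have hz0 : (0 : ℝ) < z := by positivity
  rw [← Real.le_logb_iff_rpow_le (by norm_num) hz0, div_le_iff₀ (by positivity)]
  have hl0 : 0 ≤ Real.logb 2 z :=
    Real.logb_nonneg (by norm_num) (by exact_mod_cast (by omega : 1 ≤ z))
  have hmR : (2 : ℝ) ^ m ≤ (z : ℝ) ^ (2 * k + 1) := by exact_mod_cast hm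
  have h2 := Real.logb_le_logb_of_le (b := 2) (by norm_num) (by positivity) hmR
  rw [Real.logb_pow, Real.logb_pow, Real.logb_self_eq_one (by norm_num)] at h2
  push_cast at h2
  set l := Real.logb 2 z
  have hnR : (n : ℝ) ≤ 4 * 4 ^ k * m := by exact_mod_cast hn
  have h4 : (4 : ℝ) ^ k ≤ 2 ^ (8 * k) := by
    rw [pow_mul]; gcongr; norm_num
  have hk0 : (0 : ℝ) ≤ k := by positivity
  calc (n : ℝ) ≤ 4 * 4 ^ k * m := hnR
    _ ≤ 4 * 4 ^ k * ((2 * k + 1) * l) := by gcongr; linarith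
    _ ≤ 4 * 2 ^ (8 * k) * ((2 * k + 1) * l) := by gcongr
    _ = 2 ^ (8 * k) * l * (4 * (2 * k + 1)) := by ring
    _ ≤ 2 ^ (8 * k) * l * (1024 * (8 * k + 9)) :=
      mul_le_mul_of_nonneg_left (by linarith) (by positivity)
    _ = l * (2 ^ (8 * k + 10) * (8 * k + 9)) := by rw [pow_add]; ring

/-- The denominator times `8` is at most `2 ^ 17 * 2 ^ (9 * k)`. The choice `a ≥ 18 / ε` bounds the
second factor by `n ^ (ε / 2)`, and large `n` bounds the first. The spare factor `8` serves the
change of base from `2` to `8 / 7`. -/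
theorem eventually_rpow_le_div {ε : ℝ} (hε : 0 < ε) {a : ℝ} (ha : 18 / ε ≤ a) :
    ∀ᶠ n : ℕ in atTop, ∀ k : ℕ, (k : ℝ) ≤ Real.logb 2 n / a →
      8 * (n : ℝ) ^ (1 - ε) ≤ n / (2 ^ (8 * k + 10) * (8 * k + 9)) := by
  have ha0 : 0 < a := lt_of_lt_of_le (by positivity) ha
  have htend : Tendsto (fun n : ℕ => (n : ℝ) ^ (ε / 2)) atTop atTop :=
    (tendsto_rpow_atTop (by positivity)).comp tendsto_natCast_atTop_atTop
  filter_upwards [htend.eventually_ge_atTop (2 ^ 17), eventually_ge_atTop 1] with n hn hn1 k hk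
  have hn0 : (0 : ℝ) < n := by exact_mod_cast hn1
  have hlog : 0 ≤ Real.logb 2 n := Real.logb_nonneg (by norm_num) (by exact_mod_cast hn1)
  have h9 : (2 : ℝ) ^ (9 * k) ≤ (n : ℝ) ^ (ε / 2) := by
    have h1 : 9 * (k : ℝ) ≤ Real.logb 2 n * (ε / 2) := by
      have h2 : 9 / a ≤ ε / 2 := by
        rw [div_le_iff₀ hε] at ha
        rw [div_le_div_iff₀ ha0 (by norm_num)]
        linarith
      calc 9 * (k : ℝ) ≤ 9 * (Real.logb 2 n / a) := by gcongr
        _ = Real.logb 2 n * (9 / a) := by ring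
        _ ≤ Real.logb 2 n * (ε / 2) := by gcongr
    calc (2 : ℝ) ^ (9 * k) = (2 : ℝ) ^ (9 * (k : ℝ)) := by
          rw [← Real.rpow_natCast]; push_cast; rfl
      _ ≤ (2 : ℝ) ^ (Real.logb 2 n * (ε / 2)) :=
          Real.rpow_le_rpow_of_exponent_le (by norm_num) h1
      _ = (n : ℝ) ^ (ε / 2) := by
          rw [Real.rpow_mul (by norm_num), Real.rpow_logb (by norm_num) (by norm_num) hn0]
  have hk2 : 8 * (k : ℝ) + 9 ≤ 16 * 2 ^ k := by
    have h1 := one_add_mul_le_pow (a := (1 : ℝ)) (by norm_num) k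
    norm_num at h1
    linarith
  rw [le_div_iff₀ (by positivity)]
  calc 8 * (n : ℝ) ^ (1 - ε) * (2 ^ (8 * k + 10) * (8 * k + 9))
      ≤ 8 * (n : ℝ) ^ (1 - ε) * (2 ^ (8 * k + 10) * (16 * 2 ^ k)) := by gcongr
    _ = (n : ℝ) ^ (1 - ε) * (2 ^ 17 * 2 ^ (9 * k)) := by
      rw [pow_add, show 9 * k = 8 * k + k by ring, pow_add]; ring
    _ ≤ (n : ℝ) ^ (1 - ε) * ((n : ℝ) ^ (ε / 2) * (n : ℝ) ^ (ε / 2)) := by gcongr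
    _ = n := by
      rw [← Real.rpow_add hn0, ← Real.rpow_add hn0]
      convert Real.rpow_one (n : ℝ) using 2
      ring

end BranchingPrograms

theorem theorem1 :
    ∃ c : ℝ, 0 < c ∧
      (∀ k s n : ℕ, s = 8 * k + 10 → 2 ≤ n →
        ∀ Z : BranchingPrograms.NBP (BranchingPrograms.GVar (⊤ : SimpleGraph (Fin n))),
          Z.IsVEMBP k → Z.Computes (BranchingPrograms.graphCNF (⊤ : SimpleGraph (Fin n))) →
            (8 / 7 : ℝ) ^ (c * ((n : ℝ) / ((2 : ℝ) ^ s * ((s : ℝ) - 1)))) ≤ (Z.size : ℝ)) ∧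
      (∀ k s n : ℕ, s = 8 * k + 10 → 2 ≤ n →
        ∀ Z : BranchingPrograms.NBP (BranchingPrograms.GVar (⊤ : SimpleGraph (Fin n))),
          Z.IsVOBP k → Z.Computes (BranchingPrograms.graphCNF (⊤ : SimpleGraph (Fin n))) →
            (2 : ℝ) ^ ((n : ℝ) / ((2 : ℝ) ^ s * ((s : ℝ) - 1))) ≤ (Z.size : ℝ)) ∧
      (∀ ε : ℝ, 0 < ε → ∃ a₀ : ℝ, 0 < a₀ ∧ ∀ a : ℝ, a₀ ≤ a → ∀ᶠ n : ℕ in atTop,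
        ∀ k s : ℕ, s = 8 * k + 10 → (k : ℝ) ≤ Real.logb 2 (n : ℝ) / a →
          (2 : ℝ) ^ ((n : ℝ) ^ (1 - ε)) ≤
              (8 / 7 : ℝ) ^ (c * ((n : ℝ) / ((2 : ℝ) ^ s * ((s : ℝ) - 1)))) ∧
          (2 : ℝ) ^ ((n : ℝ) ^ (1 - ε)) ≤
              (2 : ℝ) ^ ((n : ℝ) / ((2 : ℝ) ^ s * ((s : ℝ) - 1)))) := by
  have hs : ∀ k : ℕ, ((8 * k + 10 : ℕ) : ℝ) - 1 = 8 * k + 9 := by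
    intro k; push_cast; ring
  have hadj : ∀ n : ℕ, 2 ≤ n → ∃ u v : Fin n, (⊤ : SimpleGraph (Fin n)).Adj u v := fun n hn =>
    ⟨⟨0, by omega⟩, ⟨1, by omega⟩, by simp⟩
  -- The VEMBP bound is obtained with base `2`, so `c = 1` suffices for the smaller base `8 / 7`.
  refine ⟨1, one_pos, ?_, ?_, ?_⟩
  · rintro k _ n rfl hn Z hZ hc
    obtain ⟨u, v, huv⟩ := hadj n hn
    obtain ⟨m, h1, h2⟩ := hZ.exists_le hc
    rw [hs, one_mul]
    refine le_trans ?_ (BranchingPrograms.rpow_le_of_vembp_bound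
      (BranchingPrograms.NBP.two_le_size hc huv) h1 h2 hn)
    exact Real.rpow_le_rpow (by norm_num) (by norm_num) (by positivity)
  · rintro k _ n rfl hn Z hZ hc
    obtain ⟨u, v, huv⟩ := hadj n hn
    obtain ⟨m, h1, h2⟩ := hZ.exists_le hn hc
    rw [hs]
    exact BranchingPrograms.rpow_le_of_vobp_bound
      (BranchingPrograms.NBP.two_le_size hc huv) h1 h2
  · intro ε hε
    refine ⟨18 / ε, by positivity, fun a ha => ?_⟩
    filter_upwards [BranchingPrograms.eventually_rpow_le_div hε ha] with n hn
    rintro k _ rfl hk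
    have h := hn k hk
    rw [hs, one_mul]
    set x := (n : ℝ) / (2 ^ (8 * k + 10) * (8 * k + 9)) with hx
    have hp : 0 ≤ (n : ℝ) ^ (1 - ε) := by positivity
    constructor
    -- The change of base rests on `(8 / 7) ^ 8 ≥ 2`.
    · calc (2 : ℝ) ^ ((n : ℝ) ^ (1 - ε)) ≤ ((8 / 7 : ℝ) ^ (8 : ℝ)) ^ ((n : ℝ) ^ (1 - ε)) := by
            refine Real.rpow_le_rpow (by norm_num) ?_ hp
            rw [show (8 : ℝ) = ((8 : ℕ) : ℝ) by norm_num, Real.rpow_natCast]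
            norm_num
        _ = (8 / 7 : ℝ) ^ (8 * (n : ℝ) ^ (1 - ε)) := (Real.rpow_mul (by norm_num) _ _).symm
        _ ≤ (8 / 7 : ℝ) ^ x := Real.rpow_le_rpow_of_exponent_le (by norm_num) h
    · exact Real.rpow_le_rpow_of_exponent_le (by norm_num) (by linarith)
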